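/- Let $\lambda\in\mathbb C\setminus\{0\}$ not be a positive rational number, let $k\ge 1$ be an integer, and let $R$ be a function near the origin of $\mathbb C^2$ whose germ at $(0,0)$ belongs to $x^k\,\mathbb C\{x,y\}$. Consider the holomorphic foliation $\mathcal F$ defined by the $1$-form $$\omega_R=\lambda x\,dy-y(1+R)\,dx .$$ For $\rho,r>0$ put $\mathcal U(\rho,r)=\rho\mathbb D\times r\mathbb D$, where $\mathbb D$ is the open unit disc of $\mathbb C$. Where $R$ is holomorphic on $\mathcal U(\rho,r)$, let $\tilde{\mathcal F}_{\rho,r}$ be the regular foliation obtained by pulling back $\mathcal F|_{\mathcal U(\rho,r)\setminus\{x=0\}}$ by the universal covering $$\mathcal E(z,y)=(e^z,y),\qquad \mathcal E:\{(z,y): (e^z,y)\in\mathcal U(\rho,r)\}\to\mathcal U(\rho,r)\setminus\{x=0\}.$$ Leaves are endowed with their intrinsic (leaf) topology. Then: 1. There exist $\rho_0>0$ and $r_0>0$ such that $R$ is holomorphic on a neighbourhood of the closure of $\mathcal U(\rho_0,r_0)$ and, for all $0<\rho\le\rho_0$ and $0<r\le r_0$, every leaf of $\tilde{\mathcal F}_{\rho,r}$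 is simply connected. 2. Every pair $\rho_0,r_0>0$ such that $R$ is holomorphic on $\mathcal U(\rho_0,r_0)$ and $$\sup_{(x,y)\in\mathcal U(\rho_0,r_0)}|R(x,y)|<1$$ has this property: for all $0<\rho\le\rho_0$ and $0<r\le r_0$, every leaf of $\tilde{\mathcal F}_{\rho,r}$ is simply connected. -/

import Mathlib

open Set Filter Topology

noncomputable section

/-- The polydisc `ρ𝔻 × r𝔻` in `ℂ²`, with coordinates `(x, y) = (p.1, p.2)`. -/
def polydisc (ρ r : ℝ) : Set (ℂ × ℂ) :=
  Metric.ball (0 : ℂ) ρ ×ˢ Metric.ball (0 : ℂ) r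

/-- A differential `1`-form of type `(1,0)` on `ℂ²` (or on a part of it). -/
abbrev OneForm : Type := ℂ × ℂ → (ℂ × ℂ →L[ℂ] ℂ)

/-- The pull-back `F^* ω` of a `1`-form by a holomorphic map `F`. -/
def OneForm.pullback (F : ℂ × ℂ → ℂ × ℂ) (ω : OneForm) : OneForm :=
  fun p => (ω (F p)).comp (fderiv ℂ F p)

/-- The form `ω_R = λ x dy - y (1 + R) dx`. -/
def omegaForm (lam : ℂ) (R : ℂ × ℂ → ℂ) : OneForm := fun p =>
  (lam * p.1) • ContinuousLinearMap.snd ℂ ℂ ℂ -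
    (p.2 * (1 + R p)) • ContinuousLinearMap.fst ℂ ℂ ℂ

/-- The map `(z, y) ↦ (exp z, y)`. -/
def expCover (p : ℂ × ℂ) : ℂ × ℂ := (Complex.exp p.1, p.2)

/-- The domain `{(z, y) : (exp z, y) ∈ ρ𝔻 × r𝔻 \ {x = 0}}` of the universal covering
`(z, y) ↦ (exp z, y)` of the polydisc minus `{x = 0}`. -/
def coverDomain (ρ r : ℝ) : Set (ℂ × ℂ) :=
  expCover ⁻¹' (polydisc ρ r \ {p | p.1 = 0})

/-- A holomorphic disc `𝔻 → W` tangent to the kernel of `ω`. (Only the values of `toFun` on the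
open unit disc matter.) -/
structure TangentDisc (ω : OneForm) (W : Set (ℂ × ℂ)) where
  toFun : ℂ → ℂ × ℂ
  holomorphic : DifferentiableOn ℂ toFun (Metric.ball 0 1)
  mapsTo : MapsTo toFun (Metric.ball 0 1) W
  tangent : ∀ t ∈ Metric.ball (0 : ℂ) 1, ω (toFun t) (deriv toFun t) = 0

/-- The set `W` foliated by the kernel of `ω`, to be endowed with the leaf topology. It is used
for `W` open in `ℂ²` and `ω` a holomorphic form without zeros on `W`. -/
def FoliatedSpace (_ω : OneForm) (W : Set (ℂ × ℂ)) : Type := W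

/-- A tangent disc as a map from the unit disc to the foliated space. -/
def TangentDisc.toFoliatedSpace {ω : OneForm} {W : Set (ℂ × ℂ)} (φ : TangentDisc ω W) :
    Metric.ball (0 : ℂ) 1 → FoliatedSpace ω W :=
  fun t => ⟨φ.toFun t, φ.mapsTo t.2⟩

/-- The leaf topology: the finest topology for which all holomorphic discs tangent to the kernel
of `ω` are continuous. In a foliated chart `D × T` with plaques `D × {t}`, a tangent disc stays in
one plaque and the plaques are themselves tangent discs, so this is the topology of
`D × T` with `T` discrete, that is, the intrinsic topology of the leaves. -/
instance FoliatedSpace.instTopologicalSpace (ω : OneForm) (W : Set (ℂ × ℂ)) :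
    TopologicalSpace (FoliatedSpace ω W) :=
  ⨆ φ : TangentDisc ω W, TopologicalSpace.coinduced φ.toFoliatedSpace inferInstance

/-- The leaves are the connected components for the leaf topology; the topology of a leaf is the
one induced by the leaf topology. -/
def IsLeaf {ω : OneForm} {W : Set (ℂ × ℂ)} (L : Set (FoliatedSpace ω W)) : Prop :=
  ∃ p : FoliatedSpace ω W, L = connectedComponent p

/-- Every leaf of the pull-back by `(z, y) ↦ (exp z, y)` of the foliation `ω_R = 0` of
`ρ𝔻 × r𝔻 \ {x = 0}` is simply connected. -/
def LiftedLeavesSimplyConnected (lam : ℂ) (R : ℂ × ℂ → ℂ) (ρ r : ℝ) : Prop :=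
  ∀ L : Set (FoliatedSpace ((omegaForm lam R).pullback expCover) (coverDomain ρ r)),
    IsLeaf L → SimplyConnectedSpace L

/-- The eigenvalue ratio of a non-degenerate reduced singularity: it is neither zero nor a positive
rational number. -/
def IsNondegenerateReducedRatio (lam : ℂ) : Prop :=
  lam ≠ 0 ∧ ∀ q : ℚ, 0 < q → lam ≠ (q : ℂ)

/-- The germ of `R` at the origin belongs to `x^k ℂ{x, y}`. -/
def GermMemXPow (k : ℕ) (R : ℂ × ℂ → ℂ) : Prop :=
  ∃ A : ℂ × ℂ → ℂ, AnalyticAt ℂ A 0 ∧ ∀ᶠ p in 𝓝 (0 : ℂ × ℂ), R p = p.1 ^ k * A p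

/-- The pulled-back form is `exp z (λ dy - y (1 + R (exp z, y)) dz)`. -/
theorem pullback_omegaForm_apply (lam : ℂ) (R : ℂ × ℂ → ℂ) (p v : ℂ × ℂ) :
    (omegaForm lam R).pullback expCover p v =
      Complex.exp p.1 * (lam * v.2 - p.2 * (1 + R (Complex.exp p.1, p.2)) * v.1) := by
  have h : HasFDerivAt expCover
      ((Complex.exp p.1 • ContinuousLinearMap.fst ℂ ℂ ℂ).prod (ContinuousLinearMap.snd ℂ ℂ ℂ))
      p := (hasFDerivAt_fst.cexp).prodMk hasFDerivAt_snd
  simp only [OneForm.pullback, h.fderiv, omegaForm, expCover, ContinuousLinearMap.comp_apply,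
    ContinuousLinearMap.prod_apply, sub_apply, smul_apply,
    ContinuousLinearMap.coe_fst', ContinuousLinearMap.coe_snd', smul_eq_mul]
  ring

/-- The pulled-back form has no zeros, so it defines a regular foliation. -/
theorem pullback_omegaForm_ne_zero {lam : ℂ} (hlam : lam ≠ 0) (R : ℂ × ℂ → ℂ) (p : ℂ × ℂ) :
    (omegaForm lam R).pullback expCover p ≠ 0 := by
  intro h
  have h1 := pullback_omegaForm_apply lam R p (0, 1)
  rw [h] at h1
  simp [hlam, Complex.exp_ne_zero] at h1

end

/-!
The leaves of the pulled-back foliation are locally the graphs of the solutions of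
`dy/dz = y (1 + R (exp z, y)) / λ` over the half-plane `H = {z | ‖exp z‖ < ρ}`. When
`Re (1 + R) ≥ 0`, the derivative of `|y| ^ 2 / 2` in the direction `-λ` is
`-|y| ^ 2 Re (1 + R) ≤ 0`, so a solution stays in a compact part of the disc along every segment of
`H` directed by `-λ`, and extends along it. Starting from a small disc, this gives a solution on a
domain which is stable under moving forward in `H` along `-λ` and whose projection along `λ` is an
interval. Two such domains meet in a domain of the same kind, which is connected, so that solutions
which agree at a point glue: the graph of the maximal solution is the whole leaf. Its domain is
fibred by segments over an interval, hence it is contractible.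
-/

section ComplexODE

variable {E : Type*} [NormedAddCommGroup E] [NormedSpace ℂ E]

/-- `g` solves the differential equation `g' = F (w, g)` on `U`, and its graph over `U` lies in the
domain `W` of the equation. -/
def IsSolutionOn (F : ℂ × E → E) (W : Set (ℂ × E)) (g : ℂ → E) (U : Set ℂ) : Prop :=
  ∀ w ∈ U, (w, g w) ∈ W ∧ HasDerivAt g (F (w, g w)) w

variable {F : ℂ × E → E} {W : Set (ℂ × E)} {g h : ℂ → E} {U V : Set ℂ}

namespace IsSolutionOn

theorem mono (hg : IsSolutionOn F W g U) (hVU : V ⊆ U) : IsSolutionOn F W g V :=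
  fun w hw => hg w (hVU hw)

theorem congr (hU : IsOpen U) (hg : IsSolutionOn F W g U) (hhg : EqOn h g U) :
    IsSolutionOn F W h U := by
  intro w hw
  rw [hhg hw]
  exact ⟨(hg w hw).1, (hg w hw).2.congr_of_eventuallyEq (hhg.eventuallyEq_of_mem (hU.mem_nhds hw))⟩

theorem differentiableOn (hg : IsSolutionOn F W g U) : DifferentiableOn ℂ g U :=
  fun w hw => (hg w hw).2.differentiableAt.differentiableWithinAt

theorem exists_iUnion {ι : Sort*} {U : ι → Set ℂ} {g : ι → ℂ → E} (hU : ∀ i, IsOpen (U i))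
    (hg : ∀ i, IsSolutionOn F W (g i) (U i)) (hagree : ∀ i j, EqOn (g i) (g j) (U i ∩ U j)) :
    ∃ f, IsSolutionOn F W f (⋃ i, U i) ∧ ∀ i, EqOn f (g i) (U i) := by
  have hvalue : ∀ w, ∃ y, ∀ i, w ∈ U i → y = g i w := by
    intro w
    by_cases hw : ∃ i, w ∈ U i
    · obtain ⟨i, hi⟩ := hw
      exact ⟨g i w, fun j hj => hagree i j ⟨hi, hj⟩⟩
    · exact ⟨0, fun i hi => (hw ⟨i, hi⟩).elim⟩
  choose f hf using hvalue
  refine ⟨f, fun w hw => ?_, fun i w hw => hf w i hw⟩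
  obtain ⟨i, hi⟩ := mem_iUnion.1 hw
  exact (hg i).congr (hU i) (fun w hw => hf w i hw) w hi

theorem exists_union (hU : IsOpen U) (hV : IsOpen V) (hg : IsSolutionOn F W g U)
    (hh : IsSolutionOn F W h V) (hagree : EqOn g h (U ∩ V)) :
    ∃ f, IsSolutionOn F W f (U ∪ V) ∧ EqOn f g U ∧ EqOn f h V := by
  obtain ⟨f, hf, hfgh⟩ := exists_iUnion (F := F) (W := W) (U := fun b : Bool => cond b U V)
    (g := fun b => cond b g h) (Bool.forall_bool.2 ⟨hV, hU⟩) (Bool.forall_bool.2 ⟨hh, hg⟩)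
    (Bool.forall_bool.2 ⟨Bool.forall_bool.2 ⟨fun _ _ => rfl, fun w hw => (hagree hw.symm).symm⟩,
      Bool.forall_bool.2 ⟨hagree, fun _ _ => rfl⟩⟩)
  exact ⟨f, by rwa [union_eq_iUnion], hfgh true, hfgh false⟩

end IsSolutionOn

theorem hasDerivAt_comp_add_ofReal_mul {g' : E} {w v : ℂ} {t : ℝ}
    (hg : HasDerivAt g g' (w + t * v)) :
    HasDerivAt (fun s : ℝ => g (w + s * v)) (v • g') t := by
  have hline : HasDerivAt (fun s : ℝ => w + s * v) v t := by
    simpa using (Complex.ofRealCLM.hasDerivAt.mul_const v).const_add w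
  exact hg.scomp t hline

/-! ### Uniqueness -/

theorem eventually_eq_zero_of_norm_deriv_le {e : ℂ → E} {t₀ : ℂ} {K : ℝ} (h0 : e t₀ = 0)
    (he : ∀ᶠ t in 𝓝 t₀, ∃ e', HasDerivAt e e' t ∧ ‖e'‖ ≤ K * ‖e t‖) :
    ∀ᶠ t in 𝓝 t₀, e t = 0 := by
  obtain ⟨ε, hε, hball⟩ := Metric.eventually_nhds_iff_ball.1 he
  choose! e' hderiv hbound using hball
  filter_upwards [Metric.ball_mem_nhds t₀ hε] with t ht
  have hseg : ∀ s ∈ Icc (0 : ℝ) 1, t₀ + s * (t - t₀) ∈ Metric.ball t₀ ε := by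
    intro s hs
    simpa using (convex_ball t₀ ε).add_smul_sub_mem (Metric.mem_ball_self hε) ht hs
  have hd : ∀ s ∈ Icc (0 : ℝ) 1, HasDerivAt (fun s : ℝ => e (t₀ + s * (t - t₀)))
      ((t - t₀) • e' (t₀ + s * (t - t₀))) s :=
    fun s hs => hasDerivAt_comp_add_ofReal_mul (hderiv _ (hseg s hs))
  have hzero := eq_zero_of_abs_deriv_le_mul_abs_self_of_eq_zero_right (K := ‖t - t₀‖ * K)
    (fun s hs => (hd s hs).continuousAt.continuousWithinAt)
    (fun s hs => (hd s (Ico_subset_Icc_self hs)).hasDerivWithinAt) (by simp [h0])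
    (fun s hs => by
      rw [norm_smul, mul_assoc]
      gcongr
      exact hbound _ (hseg s (Ico_subset_Icc_self hs)))
    1 (right_mem_Icc.2 zero_le_one)
  simpa using hzero

theorem IsSolutionOn.eventually_curve_eq [CompleteSpace E] (hF : AnalyticOnNhd ℂ F W)
    (hU : IsOpen U) (hg : IsSolutionOn F W g U) {a : ℂ → ℂ} {b : ℂ → E} {t₀ : ℂ}
    (ha : ∀ᶠ t in 𝓝 t₀, DifferentiableAt ℂ a t)
    (hb : ∀ᶠ t in 𝓝 t₀, HasDerivAt b (deriv a t • F (a t, b t)) t)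
    (ht₀ : a t₀ ∈ U) (h0 : b t₀ = g (a t₀)) : ∀ᶠ t in 𝓝 t₀, b t = g (a t) := by
  have hac : ContinuousAt a t₀ := ha.self_of_nhds.continuousAt
  have hbc : ContinuousAt b t₀ := hb.self_of_nhds.continuousAt
  have hgc : ContinuousAt g (a t₀) := (hg _ ht₀).2.continuousAt
  obtain ⟨K, s, hs, hK⟩ := ((hF _ (hg _ ht₀).1).contDiffAt (n := 1)).exists_lipschitzOnWith
  have hdist : ∀ᶠ t in 𝓝 t₀, ‖F (a t, b t) - F (a t, g (a t))‖ ≤ K * ‖b t - g (a t)‖ := by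
    filter_upwards [(hac.prodMk hbc).eventually_mem (by rwa [h0]),
      (hac.prodMk (hgc.comp hac)).eventually_mem hs] with t hbt hgt
    simpa [Prod.norm_def] using hK.norm_sub_le hbt hgt
  have hderiv : ∀ᶠ t in 𝓝 t₀, ‖deriv a t‖ < ‖deriv a t₀‖ + 1 :=
    (Complex.analyticAt_iff_eventually_differentiableAt.2 ha).deriv.continuousAt.norm
      |>.eventually_lt_const (lt_add_one _)
  have hzero : ∀ᶠ t in 𝓝 t₀, b t - g (a t) = 0 := by
    refine eventually_eq_zero_of_norm_deriv_le (K := (‖deriv a t₀‖ + 1) * K) (by simp [h0]) ?_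
    filter_upwards [hdist, hderiv, ha, hb, hac.eventually_mem (hU.mem_nhds ht₀)]
      with t hFt ht hat hbt htU
    refine ⟨_, hbt.sub ((hg _ htU).2.scomp t hat.hasDerivAt), ?_⟩
    rw [← smul_sub, norm_smul, mul_assoc]
    gcongr
  filter_upwards [hzero] with t ht using sub_eq_zero.1 ht

theorem IsSolutionOn.eqOn_of_isPreconnected [CompleteSpace E] (hF : AnalyticOnNhd ℂ F W)
    (hU : IsOpen U) (hV : IsOpen V) (hUV : IsPreconnected (U ∩ V)) (hg : IsSolutionOn F W g U)
    (hh : IsSolutionOn F W h V) {w : ℂ} (hwU : w ∈ U) (hwV : w ∈ V) (heq : g w = h w) :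
    EqOn g h (U ∩ V) := by
  have hnear : ∀ᶠ t in 𝓝 w, g t = h t :=
    hh.eventually_curve_eq hF hV (a := id) (.of_forall fun t => differentiableAt_id)
      (by filter_upwards [hU.mem_nhds hwU] with t ht using by simpa using (hg t ht).2) hwV heq
  exact AnalyticOnNhd.eqOn_of_preconnected_of_eventuallyEq
    ((hg.differentiableOn.analyticOnNhd hU).mono inter_subset_left)
    ((hh.differentiableOn.analyticOnNhd hV).mono inter_subset_right) hUV ⟨hwU, hwV⟩ hnear

/-! ### Local existence -/

theorem exists_picardStep [CompleteSpace E] {z₀ : ℂ} {y₀ : E} {δ M : ℝ} (hM : 0 ≤ M)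
    (hF : DifferentiableOn ℂ F (Metric.ball z₀ δ ×ˢ Metric.closedBall y₀ (M * δ)))
    (hFM : ∀ p ∈ Metric.ball z₀ δ ×ˢ Metric.closedBall y₀ (M * δ), ‖F p‖ ≤ M)
    (hg : DifferentiableOn ℂ g (Metric.ball z₀ δ))
    (hgC : MapsTo g (Metric.ball z₀ δ) (Metric.closedBall y₀ (M * δ))) :
    ∃ P : ℂ → E, (∀ z ∈ Metric.ball z₀ δ, HasDerivAt P (F (z, g z)) z) ∧ P z₀ = y₀ ∧
      MapsTo P (Metric.ball z₀ δ) (Metric.closedBall y₀ (M * δ)) := by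
  have hgraph : MapsTo (fun z => (z, g z)) (Metric.ball z₀ δ)
      (Metric.ball z₀ δ ×ˢ Metric.closedBall y₀ (M * δ)) := fun z hz => ⟨hz, hgC hz⟩
  obtain ⟨P, hP₀, hP⟩ :=
    (hF.comp (differentiableOn_id.prodMk hg) hgraph).isExactOn_ball.with_val_at z₀ y₀
  refine ⟨P, hP, hP₀, fun z hz => mem_closedBall_iff_norm.2 ?_⟩
  have hz₀ : z₀ ∈ Metric.ball z₀ δ := Metric.mem_ball_self (Metric.pos_of_mem_ball hz)
  calc ‖P z - y₀‖ = ‖P z - P z₀‖ := by rw [hP₀]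
    _ ≤ M * ‖z - z₀‖ := (convex_ball z₀ δ).norm_image_sub_le_of_norm_hasDerivWithin_le
      (fun w hw => (hP w hw).hasDerivWithinAt) (fun w hw => hFM _ (hgraph hw)) hz₀ hz
    _ ≤ M * δ := by gcongr; exact (mem_ball_iff_norm.1 hz).le

theorem norm_picardStep_sub_le {z₀ : ℂ} {δ L c : ℝ} {C : Set E} {P Q : ℂ → E} (hL : 0 ≤ L)
    (hF : ∀ z ∈ Metric.ball z₀ δ, ∀ y ∈ C, ∀ y' ∈ C, ‖F (z, y) - F (z, y')‖ ≤ L * ‖y - y'‖)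
    (hgC : MapsTo g (Metric.ball z₀ δ) C) (hhC : MapsTo h (Metric.ball z₀ δ) C)
    (hP : ∀ z ∈ Metric.ball z₀ δ, HasDerivAt P (F (z, g z)) z)
    (hQ : ∀ z ∈ Metric.ball z₀ δ, HasDerivAt Q (F (z, h z)) z) (hPQ : P z₀ = Q z₀)
    (hgh : ∀ z ∈ Metric.ball z₀ δ, ‖g z - h z‖ ≤ c) {z : ℂ} (hz : z ∈ Metric.ball z₀ δ) :
    ‖P z - Q z‖ ≤ L * δ * c := by
  have hz₀ : z₀ ∈ Metric.ball z₀ δ := Metric.mem_ball_self (Metric.pos_of_mem_ball hz)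
  have hc : 0 ≤ c := (norm_nonneg _).trans (hgh z hz)
  have hderiv : ∀ w ∈ Metric.ball z₀ δ, ‖F (w, g w) - F (w, h w)‖ ≤ L * c := fun w hw =>
    (hF w hw _ (hgC hw) _ (hhC hw)).trans (mul_le_mul_of_nonneg_left (hgh w hw) hL)
  calc ‖P z - Q z‖ = ‖(P z - Q z) - (P z₀ - Q z₀)‖ := by rw [hPQ, sub_self, sub_zero]
    _ ≤ L * c * ‖z - z₀‖ := (convex_ball z₀ δ).norm_image_sub_le_of_norm_hasDerivWithin_le
      (fun w hw => ((hP w hw).sub (hQ w hw)).hasDerivWithinAt) hderiv hz₀ hz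
    _ ≤ L * c * δ := by gcongr; exact (mem_ball_iff_norm.1 hz).le
    _ = L * δ * c := by ring

theorem exists_tendstoUniformlyOn_of_le_geometric_two {α β : Type*} [PseudoMetricSpace β]
    [CompleteSpace β] {f : ℕ → α → β} {s : Set α} {C : ℝ}
    (hf : ∀ n, ∀ x ∈ s, dist (f n x) (f (n + 1) x) ≤ C / 2 / 2 ^ n) :
    ∃ f₀, TendstoUniformlyOn f f₀ atTop s := by
  have hlim : ∀ x, ∃ y, x ∈ s → Tendsto (fun n => f n x) atTop (𝓝 y) := by
    intro x
    by_cases hx : x ∈ s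
    · obtain ⟨y, hy⟩ :=
        cauchySeq_tendsto_of_complete (cauchySeq_of_le_geometric_two fun n => hf n x hx)
      exact ⟨y, fun _ => hy⟩
    · exact ⟨f 0 x, fun h => (hx h).elim⟩
  choose f₀ hf₀ using hlim
  have herror : Tendsto (fun n : ℕ => C / 2 ^ n) atTop (𝓝 0) :=
    tendsto_const_nhds.div_atTop (tendsto_pow_atTop_atTop_of_one_lt one_lt_two)
  refine ⟨f₀, Metric.tendstoUniformlyOn_iff.2 fun ε hε => ?_⟩
  filter_upwards [herror.eventually_lt_const hε] with n hn x hx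
  rw [dist_comm]
  exact (dist_le_of_le_geometric_two_of_tendsto (fun n => hf n x hx) (hf₀ x hx) n).trans_lt hn

theorem exists_mem_eqOn_of_dist_le_half {α β : Type*} [MetricSpace β] [CompleteSpace β] {s : Set α}
    {S : Set (α → β)} {T : (α → β) → α → β} {f : α → β} {C : ℝ}
    (hS : ∀ (u : ℕ → α → β) (u₀ : α → β), (∀ n, u n ∈ S) → TendstoUniformlyOn u u₀ atTop s → u₀ ∈ S)
    (hTS : MapsTo T S S)
    (hT : ∀ u ∈ S, ∀ v ∈ S, ∀ c, (∀ x ∈ s, dist (u x) (v x) ≤ c) →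
      ∀ x ∈ s, dist (T u x) (T v x) ≤ c / 2)
    (hf : f ∈ S) (hfC : ∀ x ∈ s, dist (f x) (T f x) ≤ C) : ∃ g ∈ S, EqOn (T g) g s := by
  let u : ℕ → α → β := fun n => T^[n] f
  have hu : ∀ n, u (n + 1) = T (u n) := fun n => Function.iterate_succ_apply' T n f
  have huS : ∀ n, u n ∈ S := fun n => hTS.iterate n hf
  have hdist : ∀ n, ∀ x ∈ s, dist (u n x) (u (n + 1) x) ≤ 2 * C / 2 / 2 ^ n := by
    intro n
    induction n with
    | zero => simpa [u] using hfC
    | succ n ih =>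
      intro x hx
      rw [hu, hu (n + 1), pow_succ, ← div_div]
      exact hT _ (huS n) _ (huS (n + 1)) _ ih x hx
  obtain ⟨g, hg⟩ := exists_tendstoUniformlyOn_of_le_geometric_two hdist
  have hgS : g ∈ S := hS u g huS hg
  refine ⟨g, hgS, fun x hx => tendsto_nhds_unique (f := fun n => u (n + 1) x)
    (Metric.tendsto_atTop.2 fun ε hε => ?_) ((hg.tendsto_at hx).comp (tendsto_add_atTop_nat 1))⟩
  obtain ⟨N, hN⟩ := eventually_atTop.1 (Metric.tendstoUniformlyOn_iff.1 hg ε hε)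
  refine ⟨N, fun n hn => ?_⟩
  rw [hu]
  refine (hT (u n) (huS n) g hgS ε (fun w hw => ?_) x hx).trans_lt (half_lt_self hε)
  rw [dist_comm]
  exact (hN n hn w hw).le

theorem exists_isSolutionOn_ball [CompleteSpace E] {z₀ : ℂ} {y₀ : E} {δ M L : ℝ} (hδ : 0 < δ)
    (hM : 0 ≤ M) (hL : 0 ≤ L) (hLδ : L * δ ≤ 1 / 2)
    (hF : DifferentiableOn ℂ F (Metric.ball z₀ δ ×ˢ Metric.closedBall y₀ (M * δ)))
    (hFM : ∀ p ∈ Metric.ball z₀ δ ×ˢ Metric.closedBall y₀ (M * δ), ‖F p‖ ≤ M)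
    (hFL : ∀ z ∈ Metric.ball z₀ δ, ∀ y ∈ Metric.closedBall y₀ (M * δ),
      ∀ y' ∈ Metric.closedBall y₀ (M * δ), ‖F (z, y) - F (z, y')‖ ≤ L * ‖y - y'‖) :
    ∃ g, IsSolutionOn F (Metric.ball z₀ δ ×ˢ Metric.closedBall y₀ (M * δ)) g (Metric.ball z₀ δ) ∧
      g z₀ = y₀ := by
  set B := Metric.ball z₀ δ
  set C := Metric.closedBall y₀ (M * δ)
  let S : Set (ℂ → E) := {g | DifferentiableOn ℂ g B ∧ MapsTo g B C ∧ g z₀ = y₀}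
  have hz₀ : z₀ ∈ B := Metric.mem_ball_self hδ
  have hpicard : ∀ g ∈ S, ∃ P : ℂ → E, (∀ z ∈ B, HasDerivAt P (F (z, g z)) z) ∧ P z₀ = y₀ ∧
      MapsTo P B C := fun g hg => exists_picardStep hM hF hFM hg.1 hg.2.1
  choose! T hT hT₀ hTC using hpicard
  have hTS : MapsTo T S S := fun g hg =>
    ⟨fun z hz => (hT g hg z hz).differentiableAt.differentiableWithinAt, hTC g hg, hT₀ g hg⟩
  have hcontract : ∀ g ∈ S, ∀ h ∈ S, ∀ c, (∀ z ∈ B, dist (g z) (h z) ≤ c) →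
      ∀ z ∈ B, dist (T g z) (T h z) ≤ c / 2 := by
    intro g hg h hh c hgh z hz
    have hc : 0 ≤ c := dist_nonneg.trans (hgh z hz)
    simp only [dist_eq_norm] at hgh ⊢
    calc ‖T g z - T h z‖ ≤ L * δ * c := norm_picardStep_sub_le hL hFL hg.2.1 hh.2.1
          (hT g hg) (hT h hh) ((hT₀ g hg).trans (hT₀ h hh).symm) hgh hz
      _ ≤ 1 / 2 * c := by gcongr
      _ = c / 2 := by ring
  have hclosed : ∀ (u : ℕ → ℂ → E) (g : ℂ → E), (∀ n, u n ∈ S) →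
      TendstoUniformlyOn u g atTop B → g ∈ S := fun u g hu hg =>
    ⟨hg.tendstoLocallyUniformlyOn.differentiableOn (.of_forall fun n => (hu n).1)
        Metric.isOpen_ball,
      fun z hz => Metric.isClosed_closedBall.mem_of_tendsto (hg.tendsto_at hz)
        (.of_forall fun n => (hu n).2.1 hz),
      tendsto_nhds_unique (hg.tendsto_at hz₀)
        (tendsto_const_nhds.congr fun n => (hu n).2.2.symm)⟩
  have hconst : (fun _ => y₀) ∈ S := ⟨differentiableOn_const _,
    fun _ _ => Metric.mem_closedBall_self (mul_nonneg hM hδ.le), rfl⟩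
  obtain ⟨g, hg, hTg⟩ := exists_mem_eqOn_of_dist_le_half hclosed hTS hcontract hconst
    (C := M * δ) fun z hz => by
      rw [dist_comm]
      exact Metric.mem_closedBall.1 (hTC _ hconst hz)
  exact ⟨g, fun z hz => ⟨⟨hz, hg.2.1 hz⟩, (hT g hg z hz).congr_of_eventuallyEq
    (hTg.symm.eventuallyEq_of_mem (Metric.isOpen_ball.mem_nhds hz))⟩, hg.2.2⟩

theorem eventually_exists_isSolutionOn_ball [CompleteSpace E] (hF : AnalyticOnNhd ℂ F W)
    (hW : IsOpen W) {p : ℂ × E} (hp : p ∈ W) :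
    ∃ δ > 0, ∀ᶠ q in 𝓝 p, ∃ g, IsSolutionOn F W g (Metric.ball q.1 δ) ∧ g q.1 = q.2 := by
  obtain ⟨L, s, hs, hL⟩ := ((hF p hp).contDiffAt (n := 1)).exists_lipschitzOnWith
  have hbound : ∀ᶠ q in 𝓝 p, ‖F q‖ < ‖F p‖ + 1 :=
    (hF p hp).continuousAt.norm.eventually_lt_const (lt_add_one _)
  obtain ⟨ε, hε, hball⟩ := Metric.eventually_nhds_iff_ball.1
    (hbound.and (inter_mem hs (hW.mem_nhds hp)))
  set M := ‖F p‖ + 1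
  obtain ⟨δ, hδ, hδε, hMδ, hLδ⟩ : ∃ δ > 0, δ ≤ ε / 2 ∧ M * δ < ε / 2 ∧ L * δ ≤ 1 / 2 := by
    have hsmall : ∀ᶠ δ : ℝ in 𝓝[>] 0, δ < ε / 2 ∧ M * δ < ε / 2 ∧ L * δ < 1 / 2 := by
      refine eventually_nhdsWithin_of_eventually_nhds (.and ?_ (.and ?_ ?_)) <;>
      exact Continuous.continuousAt (by fun_prop) |>.eventually_lt_const (by simp [hε])
    obtain ⟨δ, hδ, h⟩ := (eventually_mem_nhdsWithin.and hsmall).exists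
    exact ⟨δ, hδ, h.1.le, h.2.1, h.2.2.le⟩
  have hM : 0 ≤ M := by positivity
  refine ⟨δ, hδ, ?_⟩
  filter_upwards [Metric.ball_mem_nhds p (half_pos hε)] with q hq
  have hsub : Metric.ball q.1 δ ×ˢ Metric.closedBall q.2 (M * δ) ⊆ Metric.ball p ε := by
    rintro ⟨z, y⟩ ⟨hz, hy⟩
    rw [← ball_prod_same] at hq ⊢
    exact ⟨(dist_triangle z q.1 p.1).trans_lt
        (by linarith [Metric.mem_ball.1 hz, Metric.mem_ball.1 hq.1]),
      (dist_triangle y q.2 p.2).trans_lt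
        (by linarith [Metric.mem_closedBall.1 hy, Metric.mem_ball.1 hq.2])⟩
  obtain ⟨g, hg, hgq⟩ := exists_isSolutionOn_ball (F := F) (y₀ := q.2) hδ hM L.2 hLδ
    (hF.differentiableOn.mono fun x hx => (hball x (hsub hx)).2.2)
    (fun x hx => (hball x (hsub hx)).1.le) (fun z hz y hy y' hy' => by
      simpa [Prod.norm_def] using hL.norm_sub_le (hball _ (hsub (mk_mem_prod hz hy))).2.1
        (hball _ (hsub (mk_mem_prod hz hy'))).2.1)
  exact ⟨g, fun z hz => ⟨(hball _ (hsub (hg z hz).1)).2.2, (hg z hz).2⟩, hgq⟩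

theorem exists_isSolutionOn_ball_of_isCompact [CompleteSpace E] (hF : AnalyticOnNhd ℂ F W)
    (hW : IsOpen W) {K : Set (ℂ × E)} (hK : IsCompact K) (hKW : K ⊆ W) :
    ∃ δ > 0, ∀ q ∈ K, ∃ g, IsSolutionOn F W g (Metric.ball q.1 δ) ∧ g q.1 = q.2 := by
  refine hK.induction_on (p := fun K => ∃ δ > 0, ∀ q ∈ K, ∃ g,
    IsSolutionOn F W g (Metric.ball q.1 δ) ∧ g q.1 = q.2) ⟨1, one_pos, by simp⟩ ?_ ?_ ?_
  · rintro s t hst ⟨δ, hδ, ht⟩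
    exact ⟨δ, hδ, fun q hq => ht q (hst hq)⟩
  · rintro s t ⟨δ₁, hδ₁, hs⟩ ⟨δ₂, hδ₂, ht⟩
    refine ⟨min δ₁ δ₂, lt_min hδ₁ hδ₂, fun q hq => hq.elim (fun hq => ?_) fun hq => ?_⟩
    · obtain ⟨g, hg, hgq⟩ := hs q hq
      exact ⟨g, hg.mono (Metric.ball_subset_ball (min_le_left _ _)), hgq⟩
    · obtain ⟨g, hg, hgq⟩ := ht q hq
      exact ⟨g, hg.mono (Metric.ball_subset_ball (min_le_right _ _)), hgq⟩
  · intro p hp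
    obtain ⟨δ, hδ, h⟩ := eventually_exists_isSolutionOn_ball hF hW (hKW hp)
    exact ⟨_, mem_nhdsWithin_of_mem_nhds h, δ, hδ, fun q hq => hq⟩

/-! ### Continuation along a direction -/

/-- The union of the translates of `B` by `t v` for `0 ≤ t ≤ T`: a neighbourhood of a segment
directed by `v` along which a solution is continued. -/
def strip (v : ℂ) (B : Set ℂ) (T : ℝ) : Set ℂ := {z | ∃ t ∈ Icc 0 T, z - t * v ∈ B}

section Strip

variable {v w z : ℂ} {B : Set ℂ} {T T' ε δ : ℝ}

theorem isOpen_strip (hB : IsOpen B) : IsOpen (strip v B T) := by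
  have hunion : strip v B T = ⋃ t ∈ Icc 0 T, (fun z : ℂ => z - t * v) ⁻¹' B := by
    ext z
    simp [strip]
  rw [hunion]
  exact isOpen_biUnion fun t _ => hB.preimage (by fun_prop)

theorem convex_strip (hB : Convex ℝ B) : Convex ℝ (strip v B T) := by
  rintro x ⟨s, hs, hx⟩ y ⟨t, ht, hy⟩ a b ha hb hab
  refine ⟨a * s + b * t, convex_Icc 0 T hs ht ha hb hab, ?_⟩
  have hcomb : a • x + b • y - ((a * s + b * t : ℝ) : ℂ) * v
      = a • (x - s * v) + b • (y - t * v) := by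
    simp only [Complex.real_smul]
    push_cast
    ring
  rw [hcomb]
  exact hB hx hy ha hb hab

theorem subset_strip (hT : 0 ≤ T) : B ⊆ strip v B T :=
  fun z hz => ⟨0, left_mem_Icc.2 hT, by simpa using hz⟩

theorem add_mul_mem_strip (hz : z ∈ B) {t : ℝ} (ht : t ∈ Icc 0 T) : z + t * v ∈ strip v B T :=
  ⟨t, ht, by simpa using hz⟩

theorem strip_subset_union_ball (hTT' : T' ≤ T + δ / 2 / (‖v‖ + 1)) :
    strip v (Metric.ball w (min ε (δ / 2))) T' ⊆
      strip v (Metric.ball w ε) T ∪ Metric.ball (w + T * v) δ := by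
  rintro z ⟨t, ht, hz⟩
  rcases le_or_gt t T with htT | htT
  · exact Or.inl ⟨t, ⟨ht.1, htT⟩, Metric.ball_subset_ball (min_le_left _ _) hz⟩
  · refine Or.inr (mem_ball_iff_norm.2 ?_)
    have hδ : 0 < δ := by linarith [(lt_min_iff.1 (Metric.pos_of_mem_ball hz)).2]
    have hmove : ‖((t - T : ℝ) : ℂ) * v‖ ≤ δ / 2 := by
      rw [norm_mul, Complex.norm_real, Real.norm_of_nonneg (by linarith)]
      calc (t - T) * ‖v‖ ≤ δ / 2 / (‖v‖ + 1) * (‖v‖ + 1) := by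
            gcongr <;> linarith [ht.2]
        _ = δ / 2 := by field_simp
    calc ‖z - (w + T * v)‖ = ‖(z - t * v - w) + ((t - T : ℝ) : ℂ) * v‖ := by
          congr 1
          push_cast
          ring
      _ ≤ ‖z - t * v - w‖ + ‖((t - T : ℝ) : ℂ) * v‖ := norm_add_le _ _
      _ < δ / 2 + δ / 2 := add_lt_add_of_lt_of_le
          ((mem_ball_iff_norm.1 hz).trans_le (min_le_right _ _)) hmove
      _ = δ := add_halves δ

end Strip

theorem of_forall_step_Icc {P : ℝ → Prop} {T η : ℝ} (hη : 0 < η) (h0 : P 0)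
    (hstep : ∀ s t, 0 ≤ s → s ≤ t → t ≤ T → t ≤ s + η → P s → P t) {t : ℝ} (ht : t ∈ Icc 0 T) :
    P t := by
  have hgrid : ∀ n : ℕ, n * η ≤ t → P (n * η) := by
    intro n
    induction n with
    | zero => exact fun _ => by simpa using h0
    | succ n ih =>
      intro hn
      have hle : n * η ≤ (n + 1 : ℕ) * η := by gcongr; simp
      exact hstep _ _ (by positivity) hle (hn.trans ht.2) (by push_cast; linarith)
        (ih (hle.trans hn))
  have hfloor := Nat.floor_le (div_nonneg ht.1 hη.le)
  have hlt := Nat.lt_floor_add_one (t / η)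
  rw [le_div_iff₀ hη] at hfloor
  rw [div_lt_iff₀ hη] at hlt
  exact hstep _ _ (by positivity) hfloor ht.2 (by linarith) (hgrid _ hfloor)

/-- A solution cannot cease to exist as long as it is confined in a compact set, since local
solutions exist on discs of a uniform radius. -/
theorem exists_isSolutionOn_strip_of_isCompact [CompleteSpace E] (hF : AnalyticOnNhd ℂ F W)
    (hW : IsOpen W) {K : Set (ℂ × E)} (hK : IsCompact K) (hKW : K ⊆ W) {p : ℂ × E} (hp : p ∈ K)
    {v : ℂ} {T : ℝ} (hT : 0 ≤ T)
    (hapriori : ∀ τ ∈ Icc 0 T, ∀ ε > 0, ∀ g, IsSolutionOn F W g (strip v (Metric.ball p.1 ε) τ) →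
      g p.1 = p.2 → (p.1 + τ * v, g (p.1 + τ * v)) ∈ K) :
    ∃ ε > 0, ∃ g, IsSolutionOn F W g (strip v (Metric.ball p.1 ε) T) ∧ g p.1 = p.2 := by
  obtain ⟨δ, hδ, hlocal⟩ := exists_isSolutionOn_ball_of_isCompact hF hW hK hKW
  refine of_forall_step_Icc (T := T) (P := fun τ => ∃ ε > 0, ∃ g,
    IsSolutionOn F W g (strip v (Metric.ball p.1 ε) τ) ∧ g p.1 = p.2)
    (η := δ / 2 / (‖v‖ + 1)) (by positivity) ?_ ?_ (right_mem_Icc.2 hT)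
  · obtain ⟨g, hg, hgp⟩ := hlocal p hp
    refine ⟨δ, hδ, g, hg.mono ?_, hgp⟩
    rintro z ⟨t, ht, hz⟩
    obtain rfl : t = 0 := le_antisymm ht.2 ht.1
    simpa using hz
  · rintro s t hs hst htT hts ⟨ε, hε, g, hg, hgp⟩
    have hend := hapriori s ⟨hs, hst.trans htT⟩ ε hε g hg hgp
    obtain ⟨h, hh, hhend⟩ := hlocal _ hend
    have hpε : p.1 ∈ Metric.ball p.1 ε := Metric.mem_ball_self hε
    have hSo : IsOpen (strip v (Metric.ball p.1 ε) s) := isOpen_strip Metric.isOpen_ball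
    have hagree := hg.eqOn_of_isPreconnected hF hSo Metric.isOpen_ball
      ((convex_strip (convex_ball _ _)).inter (convex_ball _ _)).isPreconnected hh
      (add_mul_mem_strip hpε (right_mem_Icc.2 hs)) (Metric.mem_ball_self hδ) hhend.symm
    obtain ⟨f, hf, hfg, -⟩ := hg.exists_union hSo Metric.isOpen_ball hh hagree
    exact ⟨min ε (δ / 2), by positivity, f, hf.mono (strip_subset_union_ball hts),
      (hfg (subset_strip hs hpε)).trans hgp⟩

/-- The domain `W` of the equation `y' = F (z, y)` projects into the open convex set `H`, and
every solution extends along the half-lines directed by `v` as long as they stay in `H`. -/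
structure IsForwardComplete (F : ℂ × E → E) (W : Set (ℂ × E)) (H : Set ℂ) (v : ℂ) : Prop where
  analyticOnNhd : AnalyticOnNhd ℂ F W
  isOpen : IsOpen H
  convex : Convex ℝ H
  ne_zero : v ≠ 0
  fst_mem : ∀ p ∈ W, p.1 ∈ H
  exists_strip : ∀ p ∈ W, ∀ T : ℝ, 0 ≤ T → p.1 + T * v ∈ H →
    ∃ ε > 0, ∃ g, IsSolutionOn F W g (strip v (Metric.ball p.1 ε) T) ∧ g p.1 = p.2

end ComplexODE

/-! ### Dissipative equations -/

section Dissipative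

variable {E : Type*} [NormedAddCommGroup E] [InnerProductSpace ℂ E] {F : ℂ × E → E}
  {W : Set (ℂ × E)} {H : Set ℂ} {v : ℂ}

/-- Along a solution of `y' = F (z, y)`, the derivative of `‖y‖ ^ 2 / 2` in the direction `v` is the
real part below: the norm of solutions does not increase in this direction. -/
def IsDissipativeOn (F : ℂ × E → E) (W : Set (ℂ × E)) (v : ℂ) : Prop :=
  ∀ p ∈ W, (inner ℂ p.2 (v • F p)).re ≤ 0

theorem IsSolutionOn.norm_add_mul_le {g : ℂ → E} {U : Set ℂ} (hF : IsDissipativeOn F W v)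
    (hg : IsSolutionOn F W g U) {w : ℂ} {T : ℝ} (hT : 0 ≤ T)
    (hU : ∀ t ∈ Icc 0 T, w + t * v ∈ U) : ‖g (w + T * v)‖ ≤ ‖g w‖ := by
  let := InnerProductSpace.complexToReal (G := E)
  have hderiv : ∀ t ∈ Icc 0 T, HasDerivAt (fun t : ℝ => ‖g (w + t * v)‖ ^ 2)
      (2 * inner ℝ (g (w + t * v)) (v • F (w + t * v, g (w + t * v)))) t := fun t ht =>
    (hasDerivAt_comp_add_ofReal_mul (hg _ (hU t ht)).2).norm_sq
  have hanti : AntitoneOn (fun t : ℝ => ‖g (w + t * v)‖ ^ 2) (Icc 0 T) := by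
    refine antitoneOn_of_deriv_nonpos (convex_Icc 0 T)
      (fun t ht => (hderiv t ht).continuousAt.continuousWithinAt)
      (fun t ht => (hderiv t (interior_subset ht)).differentiableAt.differentiableWithinAt)
      fun t ht => ?_
    rw [(hderiv t (interior_subset ht)).deriv, real_inner_eq_re_inner ℂ, RCLike.re_to_complex]
    linarith [hF _ (hg _ (hU t (interior_subset ht))).1]
  have hle := hanti (left_mem_Icc.2 hT) (right_mem_Icc.2 hT) hT
  simp only [Complex.ofReal_zero, zero_mul, add_zero] at hle
  exact (sq_le_sq₀ (norm_nonneg _) (norm_nonneg _)).1 hle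

theorem add_ofReal_mul_mem_of_convex {w : ℂ} {T t : ℝ} (hH : Convex ℝ H) (hw : w ∈ H)
    (hwT : w + T * v ∈ H) (ht : t ∈ Icc 0 T) : w + t * v ∈ H := by
  have hseg : Convex ℝ {s : ℝ | w + s * v ∈ H} := by
    exact (hH.translate_preimage_right w).linear_preimage (LinearMap.toSpanSingleton ℝ ℂ v)
  exact hseg.ordConnected.out (by simpa using hw) hwT ht

theorem IsDissipativeOn.isForwardComplete [ProperSpace E] {r : ℝ} (hH : IsOpen H)
    (hHc : Convex ℝ H) (hv : v ≠ 0) (hF : AnalyticOnNhd ℂ F (H ×ˢ Metric.ball 0 r))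
    (hdiss : IsDissipativeOn F (H ×ˢ Metric.ball 0 r) v) :
    IsForwardComplete F (H ×ˢ Metric.ball 0 r) H v where
  analyticOnNhd := hF
  isOpen := hH
  convex := hHc
  ne_zero := hv
  fst_mem := fun _ hp => hp.1
  exists_strip := by
    rintro ⟨w, y⟩ ⟨hw, hy⟩ T hT hwT
    have hsegment : IsCompact ((fun t : ℝ => w + t * v) '' Icc 0 T) :=
      isCompact_Icc.image (by fun_prop)
    refine exists_isSolutionOn_strip_of_isCompact hF (hH.prod Metric.isOpen_ball)
      (hsegment.prod (isCompact_closedBall 0 ‖y‖)) (prod_mono ?_ ?_)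
      ⟨⟨0, left_mem_Icc.2 hT, by simp⟩, by simp⟩ hT fun τ hτ ε hε g hg hgw => ?_
    · rintro _ ⟨t, ht, rfl⟩
      exact add_ofReal_mul_mem_of_convex hHc hw hwT ht
    · exact Metric.closedBall_subset_ball (mem_ball_zero_iff.1 hy)
    · refine ⟨mem_image_of_mem _ hτ, mem_closedBall_zero_iff.2 ?_⟩
      exact (hg.norm_add_mul_le hdiss hτ.1 fun t ht =>
        add_mul_mem_strip (Metric.mem_ball_self hε) ht).trans_eq (congrArg norm hgw)

end Dissipative

/-! ### Domains stable under a half-flow -/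

theorem nonempty_homotopyEquiv_image_fst_of_convex_fibers {X E : Type*}
    [PseudoEMetricSpace X] [AddCommGroup E] [Module ℝ E] [TopologicalSpace E]
    [ContinuousAdd E] [ContinuousSMul ℝ E] {Ω : Set (X × E)} (hΩ : IsOpen Ω)
    (hconv : ∀ x, Convex ℝ {y | (x, y) ∈ Ω}) :
    Nonempty (ContinuousMap.HomotopyEquiv Ω (Prod.fst '' Ω)) := by
  have hlocal : ∀ x : Prod.fst '' Ω, ∃ y, ∀ᶠ x' : Prod.fst '' Ω in 𝓝 x, (x'.1, y) ∈ Ω := by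
    rintro ⟨_, q, hq, rfl⟩
    exact ⟨q.2, ContinuousAt.eventually_mem (f := fun x' : Prod.fst '' Ω => (x'.1, q.2))
      (by fun_prop) (hΩ.mem_nhds hq)⟩
  obtain ⟨σ, hσ⟩ := exists_continuous_forall_mem_convex_of_local_const
    (fun x : Prod.fst '' Ω => hconv x) hlocal
  let proj : C(Ω, Prod.fst '' Ω) := ⟨fun q => ⟨q.1.1, mem_image_of_mem _ q.2⟩, by fun_prop⟩
  let sec : C(Prod.fst '' Ω, Ω) := ⟨fun x => ⟨(x, σ x), hσ x⟩, by fun_prop⟩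
  have hmem : ∀ (u : unitInterval) (q : Ω),
      (q.1.1, (1 - u : ℝ) • σ (proj q) + (u : ℝ) • q.1.2) ∈ Ω := fun u q =>
    hconv q.1.1 (hσ (proj q)) q.2 (sub_nonneg.2 u.2.2) u.2.1 (sub_add_cancel 1 (u : ℝ))
  exact ⟨{
    toFun := proj
    invFun := sec
    left_inv := ⟨{
      toFun := fun q => ⟨_, hmem q.1 q.2⟩
      continuous_toFun := by fun_prop
      map_zero_left := fun q => by ext <;> simp [sec, proj]
      map_one_left := fun q => by ext <;> simp }⟩
    right_inv := .refl _ }⟩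

/-- A real coordinate on `ℂ` whose level sets are the lines directed by `v`. -/
noncomputable def transverseCoord (v z : ℂ) : ℝ := (z / v).im

/-- The real coordinates on `ℂ` transverse to `v` and along `v`. -/
noncomputable def directionCoords (v : ℂ) (hv : v ≠ 0) : ℂ ≃ₜ ℝ × ℝ where
  toFun z := (transverseCoord v z, (z / v).re)
  invFun q := (q.2 + q.1 * Complex.I) * v
  left_inv z := by
    dsimp only
    rw [transverseCoord, Complex.re_add_im, div_mul_cancel₀ _ hv]
  right_inv q := by ext <;> simp [transverseCoord, hv]
  continuous_toFun := by
    unfold transverseCoord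
    fun_prop
  continuous_invFun := by fun_prop

/-- An open subset of `H` which is stable under moving forward in `H` along `v`, and whose
projection along `v` is an interval. -/
structure IsForwardDomain (H : Set ℂ) (v : ℂ) (U : Set ℂ) : Prop where
  isOpen : IsOpen U
  subset : U ⊆ H
  forward : ∀ w ∈ U, ∀ t : ℝ, 0 ≤ t → w + t * v ∈ H → w + t * v ∈ U
  ordConnected : (transverseCoord v '' U).OrdConnected

section ForwardDomain

variable {H U V : Set ℂ} {v : ℂ}

theorem transverseCoord_sub_mul (hv : v ≠ 0) (z : ℂ) (t : ℝ) :
    transverseCoord v (z - t * v) = transverseCoord v z := by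
  simp [transverseCoord, sub_div, hv]

theorem exists_eq_add_mul_of_transverseCoord_eq (hv : v ≠ 0) {a b : ℂ}
    (hab : transverseCoord v a = transverseCoord v b) : ∃ t : ℝ, b = a + t * v := by
  refine ⟨(b / v).re - (a / v).re, ?_⟩
  have hdiv : b / v = a / v + ((b / v).re - (a / v).re : ℝ) :=
    Complex.ext (by simp) (by simpa [transverseCoord] using hab.symm)
  rwa [div_eq_iff hv, add_mul, div_mul_cancel₀ _ hv] at hdiv

namespace IsForwardDomain

theorem add_mul_mem (hH : Convex ℝ H) (hU : IsForwardDomain H v U) {z : ℂ} (hz : z ∈ U) {T t : ℝ}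
    (hzT : z + T * v ∈ U) (ht : t ∈ Icc 0 T) : z + t * v ∈ U :=
  hU.forward z hz t ht.1 (add_ofReal_mul_mem_of_convex hH (hU.subset hz) (hU.subset hzT) ht)

theorem image_inter (hv : v ≠ 0) (hU : IsForwardDomain H v U) (hV : IsForwardDomain H v V) :
    transverseCoord v '' (U ∩ V) = transverseCoord v '' U ∩ transverseCoord v '' V := by
  refine Subset.antisymm (image_inter_subset _ _ _) ?_
  rintro _ ⟨⟨a, ha, rfl⟩, b, hb, hba⟩
  obtain ⟨t, rfl⟩ := exists_eq_add_mul_of_transverseCoord_eq hv hba.symm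
  rcases le_total 0 t with ht | ht
  · exact ⟨a + t * v, ⟨hU.forward a ha t ht (hV.subset hb), hb⟩, hba⟩
  · have hback : a + t * v + (-t : ℝ) * v = a := by
      push_cast
      ring
    refine ⟨a, ⟨ha, ?_⟩, rfl⟩
    rw [← hback]
    exact hV.forward _ hb (-t) (neg_nonneg.2 ht) (by rw [hback]; exact hU.subset ha)

theorem inter (hv : v ≠ 0) (hU : IsForwardDomain H v U) (hV : IsForwardDomain H v V) :
    IsForwardDomain H v (U ∩ V) where
  isOpen := hU.isOpen.inter hV.isOpen
  subset := inter_subset_left.trans hU.subset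
  forward := fun w hw t ht hwt => ⟨hU.forward w hw.1 t ht hwt, hV.forward w hw.2 t ht hwt⟩
  ordConnected := by
    rw [hU.image_inter hv hV]
    exact hU.ordConnected.inter hV.ordConnected

theorem iUnion {ι : Type*} {U : ι → Set ℂ} (hU : ∀ i, IsForwardDomain H v (U i)) {w : ℂ}
    (hw : ∀ i, w ∈ U i) : IsForwardDomain H v (⋃ i, U i) where
  isOpen := isOpen_iUnion fun i => (hU i).isOpen
  subset := iUnion_subset fun i => (hU i).subset
  forward := fun z hz t ht hzt => by
    obtain ⟨i, hi⟩ := mem_iUnion.1 hz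
    exact mem_iUnion.2 ⟨i, (hU i).forward z hi t ht hzt⟩
  ordConnected := by
    rw [image_iUnion]
    have hcommon : (⋂ i, transverseCoord v '' U i).Nonempty :=
      ⟨transverseCoord v w, mem_iInter.2 fun i => mem_image_of_mem _ (hw i)⟩
    exact (isPreconnected_iUnion hcommon fun i =>
      (hU i).ordConnected.isPreconnected).ordConnected

theorem union (hU : IsForwardDomain H v U) (hV : IsForwardDomain H v V) {w : ℂ} (hwU : w ∈ U)
    (hwV : w ∈ V) : IsForwardDomain H v (U ∪ V) := by
  rw [union_eq_iUnion]
  exact iUnion (Bool.forall_bool.2 ⟨hV, hU⟩) (Bool.forall_bool.2 ⟨hwV, hwU⟩)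

theorem contractibleSpace (hv : v ≠ 0) (hH : Convex ℝ H) (hU : IsForwardDomain H v U)
    (hne : U.Nonempty) : ContractibleSpace U := by
  set e := directionCoords v hv
  have hΩ : IsOpen (e '' U) := e.isOpenMap _ hU.isOpen
  have hconv : ∀ s, Convex ℝ {τ | (s, τ) ∈ e '' U} := by
    refine fun s => OrdConnected.convex ⟨fun a ha b hb c hc => ?_⟩
    have hmove : ∀ τ : ℝ, e.symm (s, τ) = e.symm (s, a) + (τ - a : ℝ) * v := fun τ => by
      change (τ + s * Complex.I) * v = (a + s * Complex.I) * v + (τ - a : ℝ) * v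
      push_cast
      ring
    simp only [e.image_eq_preimage_symm, mem_preimage, mem_ofPred_eq] at ha hb ⊢
    rw [hmove] at hb ⊢
    exact hU.add_mul_mem hH ha hb ⟨sub_nonneg.2 hc.1, sub_le_sub_right hc.2 a⟩
  have hbase : ContractibleSpace (Prod.fst '' (e '' U)) := by
    rw [image_image]
    exact hU.ordConnected.convex.contractibleSpace (hne.image _)
  obtain ⟨f⟩ := nonempty_homotopyEquiv_image_fst_of_convex_fibers hΩ hconv
  have hΩc : ContractibleSpace (e '' U) := f.contractibleSpace
  exact (e.image U).contractibleSpace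

theorem isPreconnected (hv : v ≠ 0) (hH : Convex ℝ H) (hU : IsForwardDomain H v U) :
    IsPreconnected U := by
  rcases U.eq_empty_or_nonempty with rfl | hne
  · exact isPreconnected_empty
  · have := hU.contractibleSpace hv hH hne
    exact isPreconnected_iff_preconnectedSpace.2 inferInstance

end IsForwardDomain

/-- The points of `H` reached from `D` by moving forward along `v`: the smallest forward domain
containing `D`, when `D` is open and connected. -/
def forwardSaturation (H : Set ℂ) (v : ℂ) (D : Set ℂ) : Set ℂ :=
  {z | z ∈ H ∧ ∃ t : ℝ, 0 ≤ t ∧ z - t * v ∈ D}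

theorem subset_forwardSaturation {D : Set ℂ} (hDH : D ⊆ H) : D ⊆ forwardSaturation H v D :=
  fun z hz => ⟨hDH hz, 0, le_rfl, by simpa using hz⟩

theorem isForwardDomain_forwardSaturation (hv : v ≠ 0) (hH : IsOpen H) {D : Set ℂ} (hD : IsOpen D)
    (hDc : IsPreconnected D) (hDH : D ⊆ H) : IsForwardDomain H v (forwardSaturation H v D) where
  isOpen := by
    have hunion : forwardSaturation H v D = ⋃ t ∈ Ici (0 : ℝ), H ∩ (fun z => z - t * v) ⁻¹' D := by
      ext z
      simp [forwardSaturation]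
    rw [hunion]
    exact isOpen_biUnion fun t _ => hH.inter (hD.preimage (by fun_prop))
  subset := fun z hz => hz.1
  forward := by
    rintro w ⟨-, s, hs, hwD⟩ t ht hwt
    refine ⟨hwt, s + t, by positivity, ?_⟩
    convert hwD using 1
    push_cast
    ring
  ordConnected := by
    have himage : transverseCoord v '' forwardSaturation H v D = transverseCoord v '' D := by
      refine Subset.antisymm ?_ (image_mono (subset_forwardSaturation hDH))
      rintro _ ⟨z, ⟨-, t, -, hz⟩, rfl⟩
      exact ⟨_, hz, transverseCoord_sub_mul hv z t⟩
    rw [himage]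
    exact (hDc.image _ (by unfold transverseCoord; fun_prop)).ordConnected

end ForwardDomain

/-! ### Forward solutions -/

section ForwardSolutions

variable {E : Type*} [NormedAddCommGroup E] [NormedSpace ℂ E] [CompleteSpace E] {F : ℂ × E → E}
  {W : Set (ℂ × E)} {H U V D : Set ℂ} {v : ℂ} {f g h : ℂ → E}

theorem IsSolutionOn.eqOn_strip_inter_strip (hF : AnalyticOnNhd ℂ F W) {B₁ B₂ : Set ℂ} {T₁ T₂ : ℝ}
    (hB₁ : IsOpen B₁) (hB₂ : IsOpen B₂) (hB₁c : Convex ℝ B₁) (hB₂c : Convex ℝ B₂) (hB₁D : B₁ ⊆ D)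
    (hB₂D : B₂ ⊆ D) (hg : IsSolutionOn F W g (strip v B₁ T₁))
    (hh : IsSolutionOn F W h (strip v B₂ T₂)) (hgf : EqOn g f (strip v B₁ T₁ ∩ D))
    (hhf : EqOn h f (strip v B₂ T₂ ∩ D)) : EqOn g h (strip v B₁ T₁ ∩ strip v B₂ T₂) := by
  rintro z hz
  obtain ⟨w, hwD, hw₁, hw₂⟩ : ∃ w ∈ D, w ∈ strip v B₁ T₁ ∧ w ∈ strip v B₂ T₂ := by
    have hback : ∀ s t : ℝ, z - s * v - (t - s : ℝ) * v = z - t * v := fun s t => by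
      push_cast
      ring
    obtain ⟨⟨t₁, ht₁, hz₁⟩, t₂, ht₂, hz₂⟩ := hz
    rcases le_total t₁ t₂ with hle | hle
    · exact ⟨z - t₁ * v, hB₁D hz₁, subset_strip (ht₁.1.trans ht₁.2) hz₁, t₂ - t₁,
        ⟨sub_nonneg.2 hle, (sub_le_self _ ht₁.1).trans ht₂.2⟩, by rwa [hback]⟩
    · exact ⟨z - t₂ * v, hB₂D hz₂, ⟨t₁ - t₂,
        ⟨sub_nonneg.2 hle, (sub_le_self _ ht₂.1).trans ht₁.2⟩, by rwa [hback]⟩,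
        subset_strip (ht₂.1.trans ht₂.2) hz₂⟩
  exact hg.eqOn_of_isPreconnected hF (isOpen_strip hB₁) (isOpen_strip hB₂)
    ((convex_strip hB₁c).inter (convex_strip hB₂c)).isPreconnected hh hw₁ hw₂
    ((hgf ⟨hw₁, hwD⟩).trans (hhf ⟨hw₂, hwD⟩).symm) hz

namespace IsForwardComplete

theorem eqOn_inter (hF : IsForwardComplete F W H v) (hU : IsForwardDomain H v U)
    (hV : IsForwardDomain H v V) (hg : IsSolutionOn F W g U) (hh : IsSolutionOn F W h V) {w : ℂ}
    (hwU : w ∈ U) (hwV : w ∈ V) (heq : g w = h w) : EqOn g h (U ∩ V) :=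
  hg.eqOn_of_isPreconnected hF.analyticOnNhd hU.isOpen hV.isOpen
    ((hU.inter hF.ne_zero hV).isPreconnected hF.ne_zero hF.convex) hh hwU hwV heq

theorem exists_strip_eqOn (hF : IsForwardComplete F W H v) (hD : IsOpen D) (hDc : Convex ℝ D)
    (hg : IsSolutionOn F W g D) {w : ℂ} (hw : w ∈ D) {T : ℝ} (hT : 0 ≤ T) (hwT : w + T * v ∈ H) :
    ∃ ε > 0, Metric.ball w ε ⊆ D ∧ ∃ h, IsSolutionOn F W h (strip v (Metric.ball w ε) T) ∧
      EqOn h g (strip v (Metric.ball w ε) T ∩ D) := by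
  obtain ⟨ε₁, hε₁, h, hh, hhw⟩ := hF.exists_strip (w, g w) (hg w hw).1 T hT hwT
  obtain ⟨ε₂, hε₂, hball⟩ := Metric.isOpen_iff.1 hD w hw
  have hε : 0 < min ε₁ ε₂ := lt_min hε₁ hε₂
  have hhε : IsSolutionOn F W h (strip v (Metric.ball w (min ε₁ ε₂)) T) := by
    refine hh.mono ?_
    rintro z ⟨t, ht, hz⟩
    exact ⟨t, ht, Metric.ball_subset_ball (min_le_left _ _) hz⟩
  exact ⟨min ε₁ ε₂, hε, (Metric.ball_subset_ball (min_le_right _ _)).trans hball, h, hhε,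
    hhε.eqOn_of_isPreconnected hF.analyticOnNhd (isOpen_strip Metric.isOpen_ball) hD
      ((convex_strip (convex_ball _ _)).inter hDc).isPreconnected hg
      (subset_strip hT (Metric.mem_ball_self hε)) hw hhw⟩

theorem exists_isSolutionOn_forwardSaturation (hF : IsForwardComplete F W H v) (hD : IsOpen D)
    (hDc : Convex ℝ D) (hg : IsSolutionOn F W g D) :
    ∃ f, IsSolutionOn F W f (forwardSaturation H v D) ∧ EqOn f g D := by
  let ι : Type := {i : ℂ × ℝ // i.1 ∈ D ∧ 0 ≤ i.2 ∧ i.1 + i.2 * v ∈ H}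
  choose ε hε hεD h hh hhg using fun i : ι => hF.exists_strip_eqOn hD hDc hg i.2.1 i.2.2.1 i.2.2.2
  obtain ⟨f, hf, hfh⟩ := IsSolutionOn.exists_iUnion
    (fun i => isOpen_strip Metric.isOpen_ball) hh fun i j =>
      (hh i).eqOn_strip_inter_strip hF.analyticOnNhd Metric.isOpen_ball Metric.isOpen_ball
        (convex_ball _ _) (convex_ball _ _) (hεD i) (hεD j) (hh j) (hhg i) (hhg j)
  refine ⟨f, hf.mono ?_, fun z hz => ?_⟩
  · rintro z ⟨hzH, t, ht, hz⟩
    let i : ι := ⟨(z - t * v, t), hz, ht, by simpa using hzH⟩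
    exact mem_iUnion.2 ⟨i, t, right_mem_Icc.2 ht, Metric.mem_ball_self (hε i)⟩
  · let i : ι := ⟨(z, 0), hz, le_rfl, by simpa using hF.fst_mem _ (hg z hz).1⟩
    have hzi : z ∈ strip v (Metric.ball z (ε i)) 0 :=
      subset_strip le_rfl (Metric.mem_ball_self (hε i))
    exact (hfh i hzi).trans (hhg i ⟨hzi, hz⟩)

theorem exists_isForwardDomain (hF : IsForwardComplete F W H v) {p : ℂ × E} (hp : p ∈ W) :
    ∃ U g, IsForwardDomain H v U ∧ IsSolutionOn F W g U ∧ p.1 ∈ U ∧ g p.1 = p.2 := by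
  obtain ⟨ε, hε, k, hk, hkp⟩ := hF.exists_strip p hp 0 le_rfl (by simpa using hF.fst_mem p hp)
  have hkD : IsSolutionOn F W k (Metric.ball p.1 ε) := hk.mono (subset_strip le_rfl)
  have hDH : Metric.ball p.1 ε ⊆ H := fun w hw => hF.fst_mem _ (hkD w hw).1
  have hpD : p.1 ∈ Metric.ball p.1 ε := Metric.mem_ball_self hε
  obtain ⟨g, hg, hgk⟩ :=
    hF.exists_isSolutionOn_forwardSaturation Metric.isOpen_ball (convex_ball _ _) hkD
  exact ⟨_, g, isForwardDomain_forwardSaturation hF.ne_zero hF.isOpen Metric.isOpen_ball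
    (convex_ball _ _).isPreconnected hDH, hg, subset_forwardSaturation hDH hpD, (hgk hpD).trans hkp⟩

theorem exists_maximal_isForwardDomain (hF : IsForwardComplete F W H v) {p : ℂ × E} (hp : p ∈ W) :
    ∃ U g, IsForwardDomain H v U ∧ IsSolutionOn F W g U ∧ p.1 ∈ U ∧ g p.1 = p.2 ∧
      ∀ V h, IsForwardDomain H v V → IsSolutionOn F W h V → ∀ w ∈ U ∩ V, g w = h w →
        V ⊆ U ∧ EqOn g h V := by
  let ι : Type _ := {i : Set ℂ × (ℂ → E) //
    IsForwardDomain H v i.1 ∧ IsSolutionOn F W i.2 i.1 ∧ p.1 ∈ i.1 ∧ i.2 p.1 = p.2}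
  obtain ⟨g, hg, hgi⟩ := IsSolutionOn.exists_iUnion (fun i : ι => i.2.1.isOpen)
    (fun i => i.2.2.1) fun i j => hF.eqOn_inter i.2.1 j.2.1 i.2.2.1 j.2.2.1 i.2.2.2.1 j.2.2.2.1
      (i.2.2.2.2.trans j.2.2.2.2.symm)
  have hU : IsForwardDomain H v (⋃ i : ι, i.1.1) :=
    IsForwardDomain.iUnion (fun i => i.2.1) fun i => i.2.2.2.1
  obtain ⟨V₀, h₀, hV₀, hh₀, hp₀, hph₀⟩ := hF.exists_isForwardDomain hp
  let i₀ : ι := ⟨(V₀, h₀), hV₀, hh₀, hp₀, hph₀⟩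
  have hpU : p.1 ∈ ⋃ i : ι, i.1.1 := mem_iUnion.2 ⟨i₀, hp₀⟩
  have hgp : g p.1 = p.2 := (hgi i₀ hp₀).trans hph₀
  refine ⟨_, g, hU, hg, hpU, hgp, fun V h hV hh w hw hgh => ?_⟩
  obtain ⟨k, hk, hkg, hkh⟩ := hg.exists_union hU.isOpen hV.isOpen hh
    (hF.eqOn_inter hU hV hg hh hw.1 hw.2 hgh)
  let j : ι := ⟨(_, k), hU.union hV hw.1 hw.2, hk, Or.inl hpU, (hkg hpU).trans hgp⟩
  exact ⟨subset_union_right.trans (subset_iUnion (fun i : ι => i.1.1) j),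
    fun z hz => (hgi j (Or.inr hz)).trans (hkh hz)⟩

end IsForwardComplete

end ForwardSolutions

/-! ### Leaves of a foliation transverse to the fibres -/

section Leaves

variable {ω : OneForm} {F : ℂ × ℂ → ℂ} {W : Set (ℂ × ℂ)} {H U : Set ℂ} {v : ℂ} {g : ℂ → ℂ}

namespace FoliatedSpace

/-- The point of `ℂ²` underlying a point of the foliated space, as a map out of the leaf
topology. -/
def val (q : FoliatedSpace ω W) : ℂ × ℂ := Subtype.val (p := (· ∈ W)) q

theorem val_injective : Function.Injective (val : FoliatedSpace ω W → ℂ × ℂ) :=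
  Subtype.val_injective

theorem val_mem (q : FoliatedSpace ω W) : q.val ∈ W := Subtype.prop (p := (· ∈ W)) q

theorem isOpen_iff {O : Set (FoliatedSpace ω W)} :
    IsOpen O ↔ ∀ φ : TangentDisc ω W, IsOpen (φ.toFoliatedSpace ⁻¹' O) := by
  simp only [isOpen_iSup_iff, isOpen_coinduced]

theorem continuous_val : Continuous (val : FoliatedSpace ω W → ℂ × ℂ) :=
  continuous_iSup_dom.2 fun φ => continuous_coinduced_dom.2
    (continuousOn_iff_continuous_domRestrict.1 φ.holomorphic.continuousOn)

end FoliatedSpace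

theorem TangentDisc.continuous_toFoliatedSpace (φ : TangentDisc ω W) :
    Continuous φ.toFoliatedSpace :=
  continuous_def.2 fun _ hO => FoliatedSpace.isOpen_iff.1 hO φ

/-- On `W`, the kernel of `ω` is the line field of slope `F`: the leaves are locally the graphs of
the solutions of `y' = F (z, y)`. -/
def OneForm.HasSlopeOn (ω : OneForm) (F : ℂ × ℂ → ℂ) (W : Set (ℂ × ℂ)) : Prop :=
  ∀ p ∈ W, ∀ u : ℂ × ℂ, ω p u = 0 ↔ u.2 = u.1 * F p

theorem TangentDisc.hasDerivAt (φ : TangentDisc ω W) {t : ℂ} (ht : t ∈ Metric.ball (0 : ℂ) 1) :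
    HasDerivAt φ.toFun (deriv φ.toFun t) t :=
  (φ.holomorphic.differentiableAt (Metric.isOpen_ball.mem_nhds ht)).hasDerivAt

theorem TangentDisc.hasDerivAt_fst (φ : TangentDisc ω W) {t : ℂ}
    (ht : t ∈ Metric.ball (0 : ℂ) 1) :
    HasDerivAt (fun t => (φ.toFun t).1) (deriv φ.toFun t).1 t := by
  simpa using (φ.hasDerivAt ht).hasFDerivAt.fst.hasDerivAt

theorem TangentDisc.hasDerivAt_snd (hω : ω.HasSlopeOn F W) (φ : TangentDisc ω W) {t : ℂ}
    (ht : t ∈ Metric.ball (0 : ℂ) 1) : HasDerivAt (fun t => (φ.toFun t).2)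
      (deriv (fun t => (φ.toFun t).1) t * F (φ.toFun t)) t := by
  rw [(φ.hasDerivAt_fst ht).deriv, ← (hω _ (φ.mapsTo ht) _).1 (φ.tangent t ht)]
  simpa using (φ.hasDerivAt ht).hasFDerivAt.snd.hasDerivAt

theorem add_ofReal_mul_mem_ball_iff {x t : ℂ} {ε : ℝ} (hε : 0 < ε) :
    x + ε * t ∈ Metric.ball x ε ↔ t ∈ Metric.ball (0 : ℂ) 1 := by
  rw [mem_ball_iff_norm, add_sub_cancel_left, norm_mul, Complex.norm_real,
    Real.norm_of_nonneg hε.le, mul_lt_iff_lt_one_right hε, mem_ball_zero_iff]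

namespace IsSolutionOn

/-- The disc `𝔻 → W` cut out on the graph of a solution by a disc of its domain. -/
def tangentDisc (hω : ω.HasSlopeOn F W) (hg : IsSolutionOn F W g U) {x : ℂ} {ε : ℝ} (hε : 0 < ε)
    (hball : Metric.ball x ε ⊆ U) : TangentDisc ω W :=
  have hmaps : ∀ t ∈ Metric.ball (0 : ℂ) 1, x + ε * t ∈ U := fun _ ht =>
    hball ((add_ofReal_mul_mem_ball_iff hε).2 ht)
  have hderiv : ∀ t ∈ Metric.ball (0 : ℂ) 1, HasDerivAt (fun t => (x + ε * t, g (x + ε * t)))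
      ((ε : ℂ), ε * F (x + ε * t, g (x + ε * t))) t := fun t ht => by
    have hline : HasDerivAt (fun t : ℂ => x + ε * t) ε t := by
      simpa using ((hasDerivAt_id t).const_mul (ε : ℂ)).const_add x
    exact hline.prodMk ((hg _ (hmaps t ht)).2.scomp t hline)
  { toFun := fun t => (x + ε * t, g (x + ε * t))
    holomorphic := fun t ht => (hderiv t ht).differentiableAt.differentiableWithinAt
    mapsTo := fun t ht => (hg _ (hmaps t ht)).1
    tangent := fun t ht => by rw [(hderiv t ht).deriv, hω _ (hg _ (hmaps t ht)).1] }

/-- The graph of a solution, as a map from its domain to the leaf topology. -/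
def graphMap (ω : OneForm) (hg : IsSolutionOn F W g U) (w : U) : FoliatedSpace ω W :=
  ⟨(w, g w), (hg w w.2).1⟩

theorem mem_range_graphMap (hg : IsSolutionOn F W g U) {q : FoliatedSpace ω W} :
    q ∈ range (hg.graphMap ω) ↔ q.val.1 ∈ U ∧ g q.val.1 = q.val.2 := by
  constructor
  · rintro ⟨w, rfl⟩
    exact ⟨w.2, rfl⟩
  · rintro ⟨hq, hgq⟩
    exact ⟨⟨q.val.1, hq⟩, FoliatedSpace.val_injective (Prod.ext rfl hgq)⟩

theorem continuous_graphMap (hω : ω.HasSlopeOn F W) (hU : IsOpen U) (hg : IsSolutionOn F W g U) :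
    Continuous (hg.graphMap ω) := by
  refine continuous_iff_continuousAt.2 fun x => ?_
  obtain ⟨ε, hε, hball⟩ := Metric.isOpen_iff.1 hU x x.2
  have hrescale : ∀ w : ℂ, x.1 + ε * ((w - x.1) / ε) = w := fun w => by
    rw [mul_div_cancel₀ _ (Complex.ofReal_ne_zero.2 hε.ne'), add_sub_cancel]
  have hscale : ∀ w ∈ Metric.ball x.1 ε, (w - x.1) / ε ∈ Metric.ball (0 : ℂ) 1 := fun w hw => by
    rwa [← add_ofReal_mul_mem_ball_iff hε, hrescale]
  have hfactor : (Subtype.val ⁻¹' Metric.ball x.1 ε).domRestrict (hg.graphMap ω) =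
      (hg.tangentDisc hω hε hball).toFoliatedSpace ∘
        fun w => ⟨(w.1.1 - x.1) / ε, hscale _ w.2⟩ := by
    funext w
    refine FoliatedSpace.val_injective ?_
    change (w.1.1, g w.1) = (fun z => (z, g z)) (x.1 + ε * ((w.1.1 - x.1) / ε))
    rw [hrescale]
  have hcont : ContinuousOn (hg.graphMap ω) (Subtype.val ⁻¹' Metric.ball x.1 ε) := by
    rw [continuousOn_iff_continuous_domRestrict, hfactor]
    exact (TangentDisc.continuous_toFoliatedSpace _).comp (by fun_prop)
  exact hcont.continuousAt ((Metric.isOpen_ball.preimage continuous_subtype_val).mem_nhds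
    (Metric.mem_ball_self hε))

theorem isEmbedding_graphMap (hω : ω.HasSlopeOn F W) (hU : IsOpen U) (hg : IsSolutionOn F W g U) :
    IsEmbedding (hg.graphMap ω) :=
  .of_comp (hg.continuous_graphMap hω hU) (continuous_fst.comp FoliatedSpace.continuous_val)
    IsEmbedding.subtypeVal

theorem isOpen_range_graphMap (hω : ω.HasSlopeOn F W) (hF : AnalyticOnNhd ℂ F W) (hU : IsOpen U)
    (hg : IsSolutionOn F W g U) : IsOpen (range (hg.graphMap ω)) := by
  refine FoliatedSpace.isOpen_iff.2 fun φ => isOpen_iff_mem_nhds.2 fun t₀ ht₀ => ?_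
  obtain ⟨hU₀, hg₀⟩ := hg.mem_range_graphMap.1 ht₀
  have hφ : ∀ᶠ t in 𝓝 t₀.1, t ∈ Metric.ball (0 : ℂ) 1 := Metric.isOpen_ball.mem_nhds t₀.2
  have hgraph : ∀ᶠ t in 𝓝 t₀.1, (φ.toFun t).2 = g (φ.toFun t).1 :=
    hg.eventually_curve_eq hF hU (hφ.mono fun t ht => (φ.hasDerivAt_fst ht).differentiableAt)
      (hφ.mono fun t ht => φ.hasDerivAt_snd hω ht) hU₀ hg₀.symm
  have hdomain : ∀ᶠ t in 𝓝 t₀.1, (φ.toFun t).1 ∈ U :=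
    (φ.hasDerivAt_fst t₀.2).continuousAt.eventually_mem (hU.mem_nhds hU₀)
  filter_upwards [continuous_subtype_val.continuousAt.eventually hgraph,
    continuous_subtype_val.continuousAt.eventually hdomain] with t htg htU
  exact hg.mem_range_graphMap.2 ⟨htU, htg.symm⟩

end IsSolutionOn

theorem IsForwardComplete.exists_connectedComponent_eq_range (hF : IsForwardComplete F W H v)
    (hω : ω.HasSlopeOn F W) (p : FoliatedSpace ω W) :
    ∃ U g, ∃ hg : IsSolutionOn F W g U, IsForwardDomain H v U ∧ U.Nonempty ∧
      connectedComponent p = range (hg.graphMap ω) := by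
  obtain ⟨U, g, hU, hg, hpU, hgp, hmax⟩ := hF.exists_maximal_isForwardDomain p.val_mem
  have hclosed : IsClosed (range (hg.graphMap ω)) := by
    refine isOpen_compl_iff.1 (isOpen_iff_mem_nhds.2 fun q hq => ?_)
    obtain ⟨V, h, hV, hh, hqV, hhq⟩ := hF.exists_isForwardDomain q.val_mem
    filter_upwards [(hh.isOpen_range_graphMap hω hF.analyticOnNhd hV.isOpen).mem_nhds
      (hh.mem_range_graphMap.2 ⟨hqV, hhq⟩)] with q' hq'V hq'U
    rw [hg.mem_range_graphMap] at hq'U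
    rw [hh.mem_range_graphMap] at hq'V
    obtain ⟨hVU, hgh⟩ := hmax V h hV hh _ ⟨hq'U.1, hq'V.1⟩ (hq'U.2.trans hq'V.2.symm)
    exact hq (hg.mem_range_graphMap.2 ⟨hVU hqV, (hgh hqV).trans hhq⟩)
  have hopen := hg.isOpen_range_graphMap hω hF.analyticOnNhd hU.isOpen
  have hpreconnected : IsPreconnected (range (hg.graphMap ω)) := by
    have := Subtype.preconnectedSpace (hU.isPreconnected hF.ne_zero hF.convex)
    exact isPreconnected_range (hg.continuous_graphMap hω hU.isOpen)
  have hp : p ∈ range (hg.graphMap ω) := hg.mem_range_graphMap.2 ⟨hpU, hgp⟩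
  exact ⟨U, g, hg, hU, ⟨_, hpU⟩, Subset.antisymm
    (IsClopen.connectedComponent_subset ⟨hclosed, hopen⟩ hp)
    (hpreconnected.subset_connectedComponent hp)⟩

theorem IsForwardComplete.simplyConnectedSpace_leaf (hF : IsForwardComplete F W H v)
    (hω : ω.HasSlopeOn F W) {L : Set (FoliatedSpace ω W)} (hL : IsLeaf L) :
    SimplyConnectedSpace L := by
  obtain ⟨p, rfl⟩ := hL
  obtain ⟨U, g, hg, hU, hne, hrange⟩ := hF.exists_connectedComponent_eq_range hω p
  have hcontractible := hU.contractibleSpace hF.ne_zero hF.convex hne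
  have hleaf := (hg.isEmbedding_graphMap hω hU.isOpen).toHomeomorph.symm.contractibleSpace
  rw [hrange]
  infer_instance

end Leaves

/-! ### The foliation `ω_R` -/

section LiftedFoliation

variable {lam : ℂ} {R : ℂ × ℂ → ℂ} {ρ ρ' r r' : ℝ} {k : ℕ}

theorem polydisc_mono (hρ : ρ ≤ ρ') (hr : r ≤ r') : polydisc ρ r ⊆ polydisc ρ' r' :=
  prod_mono (Metric.ball_subset_ball hρ) (Metric.ball_subset_ball hr)

theorem exists_closure_polydisc_subset {s : Set (ℂ × ℂ)} (hs : s ∈ 𝓝 0) :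
    ∃ ε > 0, closure (polydisc ε ε) ⊆ s := by
  obtain ⟨ε, hε, hεs⟩ := Metric.nhds_basis_closedBall.mem_iff.1 hs
  refine ⟨ε, hε, subset_trans ?_ hεs⟩
  rw [polydisc, ball_prod_same]
  exact Metric.closure_ball_subset_closedBall

theorem coverDomain_eq_prod (ρ r : ℝ) :
    coverDomain ρ r = {z : ℂ | ‖Complex.exp z‖ < ρ} ×ˢ Metric.ball (0 : ℂ) r := by
  ext p
  simp [coverDomain, expCover, polydisc]

theorem convex_setOf_norm_exp_lt (ρ : ℝ) : Convex ℝ {z : ℂ | ‖Complex.exp z‖ < ρ} := by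
  simp only [Complex.norm_exp]
  rcases le_or_gt ρ 0 with hρ | hρ
  · simp [(hρ.trans (Real.exp_pos _).le).not_gt, convex_empty]
  · simp only [← Real.lt_log_iff_exp_lt hρ]
    exact convex_halfSpace_re_lt _

/-- The slope `dy / dz` of the leaves of the pull-back of `ω_R` by `(z, y) ↦ (exp z, y)`. -/
noncomputable def liftedSlope (lam : ℂ) (R : ℂ × ℂ → ℂ) (p : ℂ × ℂ) : ℂ :=
  p.2 * (1 + R (expCover p)) / lam

theorem hasSlopeOn_pullback_omegaForm (hlam : lam ≠ 0) (R : ℂ × ℂ → ℂ) (W : Set (ℂ × ℂ)) :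
    ((omegaForm lam R).pullback expCover).HasSlopeOn (liftedSlope lam R) W := by
  intro p _ u
  rw [pullback_omegaForm_apply, mul_eq_zero_iff_left (Complex.exp_ne_zero _), sub_eq_zero,
    liftedSlope, mul_div_assoc', eq_div_iff hlam, mul_comm lam, mul_comm u.1, expCover]

theorem analyticOnNhd_liftedSlope (hlam : lam ≠ 0) (hR : AnalyticOnNhd ℂ R (polydisc ρ r)) :
    AnalyticOnNhd ℂ (liftedSlope lam R) (coverDomain ρ r) := fun _ hp =>
  have hcover : AnalyticAt ℂ expCover _ := analyticAt_fst.cexp.prod analyticAt_snd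
  (analyticAt_snd.mul (analyticAt_const.add ((hR _ hp.1).comp hcover))).div analyticAt_const hlam

/-- Moving in the direction `-λ` cancels the factor `1 / λ` of the slope: the derivative of
`|y| ^ 2 / 2` becomes `-|y| ^ 2 (1 + Re R)`. -/
theorem isDissipativeOn_liftedSlope (hlam : lam ≠ 0) (hR : ∀ p ∈ polydisc ρ r, -1 ≤ (R p).re) :
    IsDissipativeOn (liftedSlope lam R) (coverDomain ρ r) (-lam) := by
  intro p hp
  have hinner : inner ℂ p.2 (-lam • liftedSlope lam R p) =
      ((-Complex.normSq p.2 : ℝ) : ℂ) * (1 + R (expCover p)) := by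
    rw [Complex.ofReal_neg, Complex.normSq_eq_conj_mul_self, liftedSlope, RCLike.inner_apply',
      smul_eq_mul]
    field_simp
  rw [hinner, Complex.re_ofReal_mul, Complex.add_re, Complex.one_re]
  exact mul_nonpos_of_nonpos_of_nonneg (neg_nonpos.2 (Complex.normSq_nonneg _))
    (by linarith [hR _ hp.1])

theorem liftedLeavesSimplyConnected_of_neg_one_le_re (hlam : lam ≠ 0)
    (hR : AnalyticOnNhd ℂ R (polydisc ρ r)) (hre : ∀ p ∈ polydisc ρ r, -1 ≤ (R p).re) :
    LiftedLeavesSimplyConnected lam R ρ r := by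
  have hF := analyticOnNhd_liftedSlope hlam hR
  have hdiss := isDissipativeOn_liftedSlope hlam hre
  unfold LiftedLeavesSimplyConnected
  rw [coverDomain_eq_prod] at hF hdiss ⊢
  have hforward := hdiss.isForwardComplete (isOpen_lt (by fun_prop) continuous_const)
    (convex_setOf_norm_exp_lt ρ) (neg_ne_zero.2 hlam) hF
  exact fun L hL => hforward.simplyConnectedSpace_leaf (hasSlopeOn_pullback_omegaForm hlam R _) hL

theorem GermMemXPow.analyticAt (hR : GermMemXPow k R) : AnalyticAt ℂ R 0 := by
  obtain ⟨A, hA, hRA⟩ := hR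
  exact ((analyticAt_fst.pow k).mul hA).congr (hRA.mono fun p hp => hp.symm)

theorem GermMemXPow.apply_zero (hk : k ≠ 0) (hR : GermMemXPow k R) : R 0 = 0 := by
  obtain ⟨A, -, hRA⟩ := hR
  rw [hRA.self_of_nhds, Prod.fst_zero, zero_pow hk, zero_mul]

theorem neg_one_le_re_of_iSup_enorm_lt_one {X : Type*} {f : X → ℂ} {s : Set X}
    (hf : ⨆ x ∈ s, ‖f x‖ₑ < 1) {x : X} (hx : x ∈ s) : -1 ≤ (f x).re := by
  have hlt := (le_iSup₂ (f := fun x (_ : x ∈ s) => ‖f x‖ₑ) x hx).trans_lt hf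
  rw [← ofReal_norm, ENNReal.ofReal_lt_one] at hlt
  exact (abs_le.1 ((Complex.abs_re_le_norm _).trans hlt.le)).1

end LiftedFoliation

theorem mainTheorem6_general {lam : ℂ} (hlam : lam ≠ 0) {R : ℂ × ℂ → ℂ} :
    (AnalyticAt ℂ R 0 → -1 < (R 0).re → ∃ ρ₀ : ℝ, 0 < ρ₀ ∧ ∃ r₀ : ℝ, 0 < r₀ ∧
      AnalyticOnNhd ℂ R (closure (polydisc ρ₀ r₀)) ∧
      ∀ ρ r : ℝ, ρ ≤ ρ₀ → r ≤ r₀ → LiftedLeavesSimplyConnected lam R ρ r) ∧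
    (∀ ρ₀ r₀ : ℝ, AnalyticOnNhd ℂ R (polydisc ρ₀ r₀) →
      (∀ p ∈ polydisc ρ₀ r₀, -1 ≤ (R p).re) →
      ∀ ρ r : ℝ, ρ ≤ ρ₀ → r ≤ r₀ → LiftedLeavesSimplyConnected lam R ρ r) := by
  have hpolydisc : ∀ ρ₀ r₀ : ℝ, AnalyticOnNhd ℂ R (polydisc ρ₀ r₀) →
      (∀ p ∈ polydisc ρ₀ r₀, -1 ≤ (R p).re) →
      ∀ ρ r : ℝ, ρ ≤ ρ₀ → r ≤ r₀ → LiftedLeavesSimplyConnected lam R ρ r :=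
    fun ρ₀ r₀ hR hre ρ r hρ hr =>
      liftedLeavesSimplyConnected_of_neg_one_le_re hlam (hR.mono (polydisc_mono hρ hr))
        fun p hp => hre p (polydisc_mono hρ hr hp)
  refine ⟨fun hR hR0 => ?_, hpolydisc⟩
  have hre : ∀ᶠ p in 𝓝 0, -1 < (R p).re :=
    (Complex.continuous_re.continuousAt.comp hR.continuousAt).eventually_const_lt hR0
  obtain ⟨ε, hε, hball⟩ := exists_closure_polydisc_subset (hR.eventually_analyticAt.and hre)
  exact ⟨ε, hε, ε, hε, fun p hp => (hball hp).1, hpolydisc ε ε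
    (fun p hp => (hball (subset_closure hp)).1) fun p hp => (hball (subset_closure hp)).2.le⟩

theorem mainTheorem6 (lam : ℂ) (hlam : IsNondegenerateReducedRatio lam)
    (k : ℕ) (hk : 1 ≤ k) (R : ℂ × ℂ → ℂ) (hR : GermMemXPow k R) :
    (∃ ρ₀ : ℝ, 0 < ρ₀ ∧ ∃ r₀ : ℝ, 0 < r₀ ∧
      AnalyticOnNhd ℂ R (closure (polydisc ρ₀ r₀)) ∧
      ∀ ρ r : ℝ, 0 < ρ → ρ ≤ ρ₀ → 0 < r → r ≤ r₀ → LiftedLeavesSimplyConnected lam R ρ r) ∧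
    (∀ ρ₀ r₀ : ℝ, 0 < ρ₀ → 0 < r₀ →
      AnalyticOnNhd ℂ R (polydisc ρ₀ r₀) →
      (⨆ p ∈ polydisc ρ₀ r₀, ‖R p‖ₑ) < 1 →
      ∀ ρ r : ℝ, 0 < ρ → ρ ≤ ρ₀ → 0 < r → r ≤ r₀ → LiftedLeavesSimplyConnected lam R ρ r) := by
  have hR0 : -1 < (R 0).re := by simp [hR.apply_zero (Nat.one_le_iff_ne_zero.1 hk)]
  obtain ⟨hexists, hforall⟩ := mainTheorem6_general hlam.1 (R := R)
  obtain ⟨ρ₀, hρ₀, r₀, hr₀, hRa, hleaves⟩ := hexists hR.analyticAt hR0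
  exact ⟨⟨ρ₀, hρ₀, r₀, hr₀, hRa, fun ρ r _ hρ _ hr => hleaves ρ r hρ hr⟩,
    fun ρ₀ r₀ _ _ hRa hsup ρ r _ hρ _ hr => hforall ρ₀ r₀ hRa
      (fun p hp => neg_one_le_re_of_iSup_enorm_lt_one hsup hp) ρ r hρ hr⟩
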